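/- Let $F(n)_{n\ge 0}$ be the Fibonacci sequence, $F(0)=0$, $F(1)=1$, $F(n+2)=F(n+1)+F(n)$. Let $K=\mathbb{Q}_5(\phi)$, where $\phi$ is a root of $x^2-x-1$, with the absolute value extending the $5$-adic absolute value of $\mathbb{Q}_5$, and put $\sqrt5:=2\phi-1\in K$. Let $\omega(3)\in\mathbb{Z}_5$ be the Teichmüller representative of $3$, i.e. the unique $4$th root of unity in $\mathbb{Z}_5$ congruent to $3$ modulo $5$. Where the series converge in $K$, let $$\log_5 x=\sum_{m\ge 1}(-1)^{m+1}\frac{(x-1)^m}{m},\qquad \exp_5 x=\sum_{m\ge 0}\frac{x^m}{m!},\qquad \sinh_5 x=\frac{\exp_5(x)-\exp_5(-x)}{2}.$$ Then the series for $\log_5\frac{\phi}{\omega(3)}$ converges, the series for $\exp_5\!\left(\pm x\log_5\frac{\phi}{\omega(3)}\right)$ converge for every $x\in\mathbb{Z}_5$, and the function $$\mathbb{Z}_5\to K,\qquad x\mapsto \frac{2}{\sqrt5}\,\sinh_5\!\left(x\log_5\tfrac{\phi}{\omega(3)}\right)$$ is analytic on $\mathbb{Z}_5$ (that is, given on all of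 $\mathbb{Z}_5$ by a convergent power series in $x$ with coefficients in $K$) and takes the value $F(n)/\omega(3)^n$ at every integer $n\ge 0$. -/

import Mathlib

noncomputable section

/-- For a `p`-adic unit `x` there is exactly one `(p - 1)`-st root of unity in `ℤ_[p]` that is
congruent to `x` modulo `p` (for `p`-adic integers, being congruent modulo `p` means being at
distance less than `1`). -/
theorem existsUnique_teichmullerRep {p : ℕ} [Fact p.Prime] (x : ℤ_[p]) (hx : IsUnit x) :
    ∃! z : ℤ_[p], z ^ (p - 1) = 1 ∧ ‖z - x‖ < 1 := by
  have hp : p.Prime := Fact.out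
  have hx1 : ‖x‖ = 1 := PadicInt.isUnit_iff.mp hx
  have hder : ‖(Polynomial.derivative (Polynomial.X ^ (p - 1) - 1 : Polynomial ℤ_[p])).aeval x‖
      = 1 := by
    have h1 : ‖((p - 1 : ℕ) : ℤ_[p])‖ = 1 := by
      rw [PadicInt.norm_natCast_eq_one_iff]
      exact (Nat.Prime.coprime_iff_not_dvd hp).2 <| Nat.not_dvd_of_pos_of_lt (Nat.sub_pos_of_lt hp.one_lt) (Nat.sub_lt hp.pos one_pos)
    simp [Polynomial.derivative_X_pow, h1, hx1]
  have hval : ‖(Polynomial.X ^ (p - 1) - 1 : Polynomial ℤ_[p]).aeval x‖ < 1 := by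
    have h0 : (PadicInt.toZMod x : ZMod p) ≠ 0 := (hx.map PadicInt.toZMod).ne_zero
    have h2 : PadicInt.toZMod (x ^ (p - 1) - 1) = 0 := by
      rw [map_sub, map_pow, map_one, ZMod.pow_card_sub_one_eq_one h0, sub_self]
    have h3 : x ^ (p - 1) - 1 ∈ RingHom.ker (PadicInt.toZMod (p := p)) := h2
    rw [PadicInt.ker_toZMod, IsLocalRing.mem_maximalIdeal, PadicInt.mem_nonunits] at h3
    simpa using h3
  obtain ⟨z, hz0, hzx, -, huniq⟩ := hensels_lemma
    (F := (Polynomial.X ^ (p - 1) - 1 : Polynomial ℤ_[p])) (a := x) (by rw [hder]; simpa using hval)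
  rw [hder] at hzx huniq
  refine ⟨z, ⟨?_, hzx⟩, fun y hy => huniq y ?_ hy.2⟩
  · simpa [sub_eq_zero] using hz0
  · simp [hy.1]

/-- The Teichmüller representative `ω(x)` of a `p`-adic unit `x`. -/
def teichmullerRep {p : ℕ} [Fact p.Prime] (x : ℤ_[p]) (hx : IsUnit x) : ℤ_[p] :=
  (existsUnique_teichmullerRep x hx).choose

instance fact_prime_five : Fact (Nat.Prime 5) := ⟨by norm_num⟩

theorem isUnit_three_padicInt_five : IsUnit (3 : ℤ_[5]) := by
  rw [PadicInt.isUnit_iff]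
  exact_mod_cast (PadicInt.norm_natCast_eq_one_iff (p := 5) (n := 3)).2 (by norm_num)

/-- The root of unity `ω(3)` of `ℤ_[5]`, as an element of an extension `K` of `ℚ_[5]`. -/
def omegaThree (K : Type*) [Field K] [Algebra ℚ_[5] K] : K :=
  algebraMap ℚ_[5] K (teichmullerRep (3 : ℤ_[5]) isUnit_three_padicInt_five : ℤ_[5])

section Series

variable {K : Type*} [NormedField K]

/-- The terms `(-1) ^ (m + 1) * (x - 1) ^ m / m`, `m ≥ 1`, of the logarithm series, with `m`
shifted by one. -/
def padicLogTerm (x : K) (m : ℕ) : K := (-1) ^ m * (x - 1) ^ (m + 1) / ((m + 1 : ℕ) : K)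

/-- The `p`-adic logarithm on an extension `K` of `ℚ_[p]` (the value is meaningful where the
series converges). -/
def padicLog (x : K) : K := ∑' m, padicLogTerm x m

/-- The terms of the exponential series. -/
def padicExpTerm (x : K) (m : ℕ) : K := x ^ m / (Nat.factorial m : K)

/-- The `p`-adic exponential on an extension `K` of `ℚ_[p]` (the value is meaningful where the
series converges). -/
def padicExp (x : K) : K := ∑' m, padicExpTerm x m

/-- The `p`-adic hyperbolic sine. -/
def padicSinh (x : K) : K := (padicExp x - padicExp (-x)) / 2

end Series

/-- A `K`-valued function on `ℤ_[p]` is analytic if it is given on all of `ℤ_[p]` by one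
convergent power series with coefficients in `K`. -/
def IsPadicAnalytic {p : ℕ} [Fact p.Prime] {K : Type*} [NormedField K] [NormedAlgebra ℚ_[p] K]
    (f : ℤ_[p] → K) : Prop :=
  ∃ a : ℕ → K, ∀ x : ℤ_[p], HasSum (fun m => a m * algebraMap ℚ_[p] K (x : ℚ_[p]) ^ m) (f x)

/-- The function `x ↦ (2 / √5) sinh (x log (φ / ω(3)))` on `ℤ_[5]`, where `√5 = 2 φ - 1`. -/
def fibInterpolation {K : Type*} [NormedField K] [NormedAlgebra ℚ_[5] K] (φ : K) (x : ℤ_[5]) : K :=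
  2 / (2 * φ - 1) *
    padicSinh (algebraMap ℚ_[5] K (x : ℚ_[5]) * padicLog (φ / omegaThree K))

end

open Filter Topology

/-! Modulo 5, `x ^ 2 - x - 1` is `(x - 3) ^ 2`, so `φ` is close to 3 and hence to `ω(3)`: `φ / ω(3)`
lies within `5 ^ (-1 / 2)` of 1, inside the radius `5 ^ (-1 / 4)`. There `exp (log x) = x`
(`padicExp_padicLog`). Since `φ * (1 - φ) = -1 = ω(3) ^ 2`, the inverse of `φ / ω(3)` is `(1 - φ) /
ω(3)`, so at `n` the hyperbolic sine becomes Binet's formula divided by `ω(3) ^ n`.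

The inversion avoids composing power series. Along `t = p ^ n → 0`, both `(x ^ t - 1) / t` and `(exp
(log x) ^ t - 1) / t` tend to `log x`. So the quotient of `x` by `exp (log x)` has logarithm 0, and
a logarithm vanishes in the disk only at 1. -/

/-- The radius `p ^ (-1 / (p - 1))` of convergence of the `p`-adic exponential. -/
noncomputable def padicExpRadius (p : ℕ) : ℝ := (p : ℝ)⁻¹ ^ ((p - 1 : ℕ) : ℝ)⁻¹

theorem norm_sub_le_max_norm {E : Type*} [SeminormedAddCommGroup E] [IsUltrametricDist E]
    (x y : E) : ‖x - y‖ ≤ max ‖x‖ ‖y‖ := by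
  simpa [sub_eq_add_neg] using IsUltrametricDist.norm_add_le_max x (-y)

/-! ### Radius of convergence and factorials -/

section Radius

variable {p : ℕ} [hp : Fact p.Prime]

theorem padicExpRadius_pos : 0 < padicExpRadius p :=
  Real.rpow_pos_of_pos (inv_pos.2 (Nat.cast_pos.2 hp.out.pos)) _

theorem padicExpRadius_pow : padicExpRadius p ^ (p - 1) = (p : ℝ)⁻¹ :=
  Real.rpow_inv_natCast_pow (by positivity) (Nat.sub_pos_of_lt hp.out.one_lt).ne'

theorem padicExpRadius_le_one : padicExpRadius p ≤ 1 :=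
  Real.rpow_le_one (by positivity) (inv_le_one_of_one_le₀ (by exact_mod_cast hp.out.one_le))
    (by positivity)

/-- Legendre's formula: the left side is `m + 1` minus the base-`p` digit sum, which is at least 1.
-/
theorem sub_one_mul_padicValNat_factorial_succ_le (m : ℕ) :
    (p - 1) * padicValNat p (m + 1).factorial ≤ m := by
  have hs : 0 < (p.digits (m + 1)).sum := by
    have hne : p.digits (m + 1) ≠ [] := Nat.digits_ne_nil_iff_ne_zero.2 m.succ_ne_zero
    exact (Nat.pos_of_ne_zero (Nat.getLast_digit_ne_zero p m.succ_ne_zero)).trans_le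
      (List.single_le_sum (by simp) _ (List.getLast_mem hne))
  rw [sub_one_mul_padicValNat_factorial]
  omega

theorem padicExpRadius_pow_le_norm_factorial (m : ℕ) :
    padicExpRadius p ^ m ≤ ‖((m + 1).factorial : ℚ_[p])‖ := by
  rw [Padic.norm_eq_zpow_neg_valuation (by exact_mod_cast Nat.factorial_ne_zero _),
    Padic.valuation_natCast, zpow_neg, zpow_natCast, ← inv_pow, ← padicExpRadius_pow, ← pow_mul]
  exact pow_le_pow_of_le_one padicExpRadius_pos.le padicExpRadius_le_one
    (sub_one_mul_padicValNat_factorial_succ_le m)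

end Radius

/-! ### The p-adic logarithm and exponential -/

section Series

theorem norm_natCast_padicAlgebra (p : ℕ) [Fact p.Prime] {K : Type*} [NormedField K]
    [NormedAlgebra ℚ_[p] K] (n : ℕ) : ‖(n : K)‖ = ‖(n : ℚ_[p])‖ := by
  rw [← norm_algebraMap' K (n : ℚ_[p]), map_natCast]

theorem norm_natCast_padicAlgebra_le_one (p : ℕ) [Fact p.Prime] {K : Type*} [NormedField K]
    [NormedAlgebra ℚ_[p] K] (n : ℕ) : ‖(n : K)‖ ≤ 1 := by
  rw [norm_natCast_padicAlgebra p]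
  exact_mod_cast Padic.norm_int_le_one (n : ℤ)

theorem isUltrametricDist_padicAlgebra (p : ℕ) [Fact p.Prime] {K : Type*} [NormedField K]
    [NormedAlgebra ℚ_[p] K] : IsUltrametricDist K :=
  IsUltrametricDist.isUltrametricDist_of_forall_norm_natCast_le_one
    (norm_natCast_padicAlgebra_le_one p)

theorem charZero_padicAlgebra (p : ℕ) [Fact p.Prime] {K : Type*} [NormedField K]
    [NormedAlgebra ℚ_[p] K] : CharZero K :=
  charZero_of_injective_algebraMap (algebraMap ℚ_[p] K).injective

theorem padicExp_zero {K : Type*} [NormedField K] : padicExp (0 : K) = 1 := by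
  rw [padicExp, tsum_eq_single 0 (fun m hm => by simp [padicExpTerm, hm])]
  simp [padicExpTerm]

/-- Binomial expansion about 1. The finite sum is written as a series so that dominated convergence
can compare it termwise with the logarithm. -/
theorem pow_sub_one_div_eq_tsum {K : Type*} [NormedField K] [CharZero K] (x : K) {N : ℕ}
    (hN : N ≠ 0) :
    (x ^ N - 1) / N
      = ∑' k, ((N - 1).choose k : K) * ((x - 1) ^ (k + 1) / ((k + 1 : ℕ) : K)) := by
  obtain ⟨M, rfl⟩ := Nat.exists_eq_add_one_of_ne_zero hN
  have hM : ((M + 1 : ℕ) : K) ≠ 0 := by exact_mod_cast M.succ_ne_zero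
  rw [Nat.add_sub_cancel, tsum_eq_sum (s := Finset.range (M + 1)), div_eq_iff hM, Finset.sum_mul]
  · conv_lhs => rw [← sub_add_cancel x 1, add_pow, Finset.sum_range_succ']
    simp only [one_pow, mul_one, pow_zero, Nat.choose_zero_right, Nat.cast_one, add_sub_cancel_right]
    refine Finset.sum_congr rfl fun k _ => ?_
    have hk : ((k + 1 : ℕ) : K) ≠ 0 := by exact_mod_cast k.succ_ne_zero
    have h1 : ((M + 1 : ℕ) : K) * (M.choose k : K)
        = ((M + 1).choose (k + 1) : K) * ((k + 1 : ℕ) : K) := by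
      exact_mod_cast Nat.add_one_mul_choose_eq M k
    rw [← mul_div_assoc, div_mul_eq_mul_div, eq_div_iff hk]
    linear_combination -(x - 1) ^ (k + 1) * h1
  · intro k hk
    rw [Nat.choose_eq_zero_of_lt (by simpa using hk)]
    simp

theorem norm_pow_succ_div_le {p : ℕ} [Fact p.Prime] {K : Type*} [NormedField K] (y : K)
    {c : K} {m : ℕ} (hc : padicExpRadius p ^ m ≤ ‖c‖) :
    ‖y ^ (m + 1) / c‖ ≤ ‖y‖ * (‖y‖ / padicExpRadius p) ^ m := by
  have hq : 0 < padicExpRadius p := padicExpRadius_pos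
  rw [norm_div, norm_pow, div_pow, pow_succ', mul_div_assoc]
  gcongr

variable (p : ℕ) [hp : Fact p.Prime] {K : Type*} [NormedField K] [NormedAlgebra ℚ_[p] K]

theorem padicExpRadius_pow_le_norm_factorial_cast (m : ℕ) :
    padicExpRadius p ^ m ≤ ‖((m + 1).factorial : K)‖ := by
  rw [norm_natCast_padicAlgebra p]
  exact padicExpRadius_pow_le_norm_factorial m

theorem padicExpRadius_pow_le_norm_succ_cast (m : ℕ) :
    padicExpRadius p ^ m ≤ ‖((m + 1 : ℕ) : K)‖ := by
  refine (padicExpRadius_pow_le_norm_factorial_cast p (K := K) m).trans ?_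
  rw [Nat.factorial_succ, Nat.cast_mul, norm_mul]
  exact mul_le_of_le_one_right (norm_nonneg _) (norm_natCast_padicAlgebra_le_one p _)

variable {p}

theorem norm_padicLogTerm_le (x : K) (m : ℕ) :
    ‖padicLogTerm x m‖ ≤ ‖x - 1‖ * (‖x - 1‖ / padicExpRadius p) ^ m := by
  rw [padicLogTerm, mul_div_assoc, norm_mul, norm_pow, norm_neg, norm_one, one_pow, one_mul]
  exact norm_pow_succ_div_le _ (padicExpRadius_pow_le_norm_succ_cast p m)

theorem norm_padicExpTerm_succ_le (y : K) (m : ℕ) :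
    ‖padicExpTerm y (m + 1)‖ ≤ ‖y‖ * (‖y‖ / padicExpRadius p) ^ m :=
  norm_pow_succ_div_le _ (padicExpRadius_pow_le_norm_factorial_cast p m)

theorem summable_padicBound {r : ℝ} (hr : 0 ≤ r) (h : r < padicExpRadius p) :
    Summable fun m : ℕ => r * (r / padicExpRadius p) ^ m :=
  (summable_geometric_of_lt_one (div_nonneg hr padicExpRadius_pos.le)
    ((div_lt_one padicExpRadius_pos).2 h)).mul_left r

theorem padicBound_le {r : ℝ} (hr : 0 ≤ r) (h : r < padicExpRadius p) (m : ℕ) :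
    r * (r / padicExpRadius p) ^ m ≤ r :=
  mul_le_of_le_one_right hr
    (pow_le_one₀ (div_nonneg hr padicExpRadius_pos.le) ((div_le_one padicExpRadius_pos).2 h.le))

theorem summable_norm_padicExpTerm {y : K} (hy : ‖y‖ < padicExpRadius p) :
    Summable fun m => ‖padicExpTerm y m‖ :=
  (summable_nat_add_iff 1).1 <| (summable_padicBound (norm_nonneg y) hy).of_nonneg_of_le
    (fun _ => norm_nonneg _) (norm_padicExpTerm_succ_le y)

variable (p K) in
theorem tendsto_prime_pow_cast : Tendsto (fun n : ℕ => ((p ^ n : ℕ) : K)) atTop (𝓝 0) := by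
  simp only [Nat.cast_pow]
  refine tendsto_pow_atTop_nhds_zero_of_norm_lt_one ?_
  rw [norm_natCast_padicAlgebra p]
  exact Padic.norm_p_lt_one

/-- Pascal's rule gives `C(N-1, k+1) = N * C(N-1, k) / (k+1) - C(N-1, k)`, and `N = p ^ n` tends to
0 in `K`. -/
theorem choose_prime_pow_sub_one_tendsto (k : ℕ) :
    Tendsto (fun n : ℕ => ((p ^ n - 1).choose k : K)) atTop (𝓝 ((-1) ^ k)) := by
  have := charZero_padicAlgebra p (K := K)
  induction k with
  | zero => simp
  | succ k ih =>
    have key : ∀ n : ℕ, ((p ^ n - 1).choose (k + 1) : K)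
        = ((p ^ n : ℕ) : K) * ((p ^ n - 1).choose k : K) / ((k + 1 : ℕ) : K)
          - ((p ^ n - 1).choose k : K) := fun n => by
      have hk : ((k + 1 : ℕ) : K) ≠ 0 := by exact_mod_cast k.succ_ne_zero
      obtain ⟨N, hN⟩ := Nat.exists_eq_add_one_of_ne_zero (pow_ne_zero n hp.out.ne_zero)
      have h1 : ((N + 1 : ℕ) : K) * (N.choose k : K)
          = ((N.choose k : K) + (N.choose (k + 1) : K)) * ((k + 1 : ℕ) : K) := by
        exact_mod_cast Nat.choose_succ_succ N k ▸ Nat.add_one_mul_choose_eq N k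
      rw [hN, Nat.add_sub_cancel, h1, mul_div_cancel_right₀ _ hk, add_sub_cancel_left]
    simp only [key]
    simpa [pow_succ] using
      (((tendsto_prime_pow_cast p K).mul ih).div_const ((k + 1 : ℕ) : K)).sub ih

theorem norm_natCast_mul_lt {y : K} (hy : ‖y‖ < padicExpRadius p) (n : ℕ) :
    ‖(n : K) * y‖ < padicExpRadius p := by
  rw [norm_mul]
  exact (mul_le_of_le_one_left (norm_nonneg _) (norm_natCast_padicAlgebra_le_one p n)).trans_lt hy

theorem norm_padicLog_le {x : K} (hx : ‖x - 1‖ < padicExpRadius p) :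
    ‖padicLog x‖ ≤ ‖x - 1‖ := by
  have := isUltrametricDist_padicAlgebra p (K := K)
  exact (IsUltrametricDist.norm_tsum_le _).trans <| Real.iSup_le
    (fun m => (norm_padicLogTerm_le x m).trans (padicBound_le (norm_nonneg _) hx m))
    (norm_nonneg _)

variable [CompleteSpace K]

theorem summable_padicExpTerm {y : K} (hy : ‖y‖ < padicExpRadius p) :
    Summable (padicExpTerm y) :=
  (summable_norm_padicExpTerm hy).of_norm

theorem summable_padicLogTerm {x : K} (hx : ‖x - 1‖ < padicExpRadius p) :
    Summable (padicLogTerm x) :=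
  .of_norm_bounded (summable_padicBound (norm_nonneg _) hx) (norm_padicLogTerm_le x)

theorem padicExp_eq_one_add {y : K} (hy : ‖y‖ < padicExpRadius p) :
    padicExp y = 1 + ∑' m, padicExpTerm y (m + 1) := by
  rw [padicExp, (summable_padicExpTerm hy).tsum_eq_zero_add]
  simp [padicExpTerm]

theorem norm_padicExp_sub_one_le {y : K} (hy : ‖y‖ < padicExpRadius p) :
    ‖padicExp y - 1‖ ≤ ‖y‖ := by
  have := isUltrametricDist_padicAlgebra p (K := K)
  rw [padicExp_eq_one_add hy, add_sub_cancel_left]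
  exact (IsUltrametricDist.norm_tsum_le _).trans <| Real.iSup_le
    (fun m => (norm_padicExpTerm_succ_le y m).trans (padicBound_le (norm_nonneg _) hy m))
    (norm_nonneg _)

theorem padicExp_add {x y : K} (hx : ‖x‖ < padicExpRadius p) (hy : ‖y‖ < padicExpRadius p) :
    padicExp (x + y) = padicExp x * padicExp y := by
  have := charZero_padicAlgebra p (K := K)
  have hmul := tsum_mul_tsum_eq_tsum_sum_antidiagonal_of_summable_norm
    (f := padicExpTerm x) (g := padicExpTerm y)
    (summable_norm_padicExpTerm hx) (summable_norm_padicExpTerm hy)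
  refine Eq.trans ?_ hmul.symm
  refine tsum_congr fun n => ?_
  rw [padicExpTerm, (Commute.all x y).add_pow', Finset.sum_div]
  refine Finset.sum_congr rfl fun ij hij => ?_
  have hn : (n.factorial : K) ≠ 0 := by exact_mod_cast n.factorial_ne_zero
  have hi : (ij.1.factorial : K) ≠ 0 := by exact_mod_cast ij.1.factorial_ne_zero
  have hj : (ij.2.factorial : K) ≠ 0 := by exact_mod_cast ij.2.factorial_ne_zero
  have hc : (n.choose ij.1 : K) * ij.1.factorial * ij.2.factorial = n.factorial := by
    have h := Nat.add_choose_mul_factorial_mul_factorial ij.1 ij.2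
    have hn := Finset.HasAntidiagonal.mem_antidiagonal.1 hij
    rw [hn] at h
    rw [Nat.choose_symm_of_eq_add hn.symm, ← h, Nat.cast_mul, Nat.cast_mul]
  rw [padicExpTerm, padicExpTerm, nsmul_eq_mul, div_mul_div_comm,
    div_eq_div_iff hn (mul_ne_zero hi hj), ← hc]
  ring

theorem padicExp_natCast_mul {y : K} (hy : ‖y‖ < padicExpRadius p) (n : ℕ) :
    padicExp (n * y) = padicExp y ^ n := by
  induction n with
  | zero => simp [padicExp_zero]
  | succ n ih =>
    rw [Nat.cast_succ, add_one_mul, padicExp_add (norm_natCast_mul_lt hy n) hy, ih, pow_succ]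

theorem padicExp_mul_padicExp_neg {y : K} (hy : ‖y‖ < padicExpRadius p) :
    padicExp y * padicExp (-y) = 1 := by
  rw [← padicExp_add hy (by rwa [norm_neg]), add_neg_cancel, padicExp_zero]

/-- The logarithm is the derivative at `0` of `t ↦ x ^ t`, along the powers of `p`. -/
theorem tendsto_pow_sub_one_div {x : K} (hx : ‖x - 1‖ < padicExpRadius p) :
    Tendsto (fun n : ℕ => (x ^ p ^ n - 1) / ((p ^ n : ℕ) : K)) atTop (𝓝 (padicLog x)) := by
  have := charZero_padicAlgebra p (K := K)
  simp only [pow_sub_one_div_eq_tsum x (pow_ne_zero _ hp.out.ne_zero)]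
  refine tendsto_tsum_of_dominated_convergence (summable_padicBound (norm_nonneg _) hx)
    (fun k => ?_) (Eventually.of_forall fun n k => ?_)
  · rw [padicLogTerm, mul_div_assoc]
    exact (choose_prime_pow_sub_one_tendsto k).mul_const _
  · rw [norm_mul]
    exact (mul_le_of_le_one_left (norm_nonneg _) (norm_natCast_padicAlgebra_le_one p _)).trans
      (norm_pow_succ_div_le _ (padicExpRadius_pow_le_norm_succ_cast p k))

/-- The quotient is a power series in `p ^ n` with constant term `y`, because `exp y ^ p ^ n = exp
(p ^ n * y)`. -/
theorem tendsto_padicExp_sub_one_div {y : K} (hy : ‖y‖ < padicExpRadius p) :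
    Tendsto (fun n : ℕ => (padicExp y ^ p ^ n - 1) / ((p ^ n : ℕ) : K)) atTop (𝓝 y) := by
  have := charZero_padicAlgebra p (K := K)
  have h1 : ∀ n : ℕ, (padicExp y ^ p ^ n - 1) / ((p ^ n : ℕ) : K)
      = ∑' m, ((p ^ n : ℕ) : K) ^ m * padicExpTerm y (m + 1) := fun n => by
    have hn : ((p ^ n : ℕ) : K) ≠ 0 := by exact_mod_cast pow_ne_zero n hp.out.ne_zero
    rw [← padicExp_natCast_mul hy, padicExp_eq_one_add (norm_natCast_mul_lt hy _),
      add_sub_cancel_left, div_eq_iff hn, ← tsum_mul_right]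
    refine tsum_congr fun m => ?_
    rw [padicExpTerm, padicExpTerm]
    ring
  -- The limit series at `p ^ n = 0`; only the term with `0 ^ 0 = 1` survives.
  have h2 : y = ∑' m, (0 : K) ^ m * padicExpTerm y (m + 1) := by
    rw [tsum_eq_single 0 (fun m hm => by simp [hm])]
    simp [padicExpTerm]
  simp only [h1]
  conv => rhs; rw [h2]
  refine tendsto_tsum_of_dominated_convergence (summable_padicBound (norm_nonneg y) hy)
    (fun m => ((tendsto_prime_pow_cast p K).pow m).mul_const _)
    (Eventually.of_forall fun n m => ?_)
  rw [norm_mul, norm_pow]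
  exact (mul_le_of_le_one_left (norm_nonneg _)
    (pow_le_one₀ (norm_nonneg _) (norm_natCast_padicAlgebra_le_one p _))).trans
      (norm_padicExpTerm_succ_le y m)

/-- The leading term `x - 1` strictly dominates the rest of the series in norm, so it cannot be
cancelled. -/
theorem eq_one_of_padicLog_eq_zero {x : K} (hx : ‖x - 1‖ < padicExpRadius p)
    (h : padicLog x = 0) : x = 1 := by
  have := isUltrametricDist_padicAlgebra p (K := K)
  by_contra hne
  have hpos : 0 < ‖x - 1‖ := norm_pos_iff.2 (sub_ne_zero.2 hne)
  have hr : ‖x - 1‖ / padicExpRadius p < 1 := (div_lt_one padicExpRadius_pos).2 hx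
  have hr0 : 0 ≤ ‖x - 1‖ / padicExpRadius p := div_nonneg hpos.le padicExpRadius_pos.le
  have htail : ‖∑' m, padicLogTerm x (m + 1)‖ ≤ ‖x - 1‖ * (‖x - 1‖ / padicExpRadius p) := by
    refine (IsUltrametricDist.norm_tsum_le _).trans <| Real.iSup_le
      (fun m => (norm_padicLogTerm_le (p := p) x (m + 1)).trans ?_) (by positivity)
    gcongr
    exact pow_le_of_le_one hr0 hr.le m.succ_ne_zero
  rw [padicLog, (summable_padicLogTerm hx).tsum_eq_zero_add,
    show padicLogTerm x 0 = x - 1 by simp [padicLogTerm]] at h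
  rw [← norm_neg, ← eq_neg_of_add_eq_zero_left h] at htail
  nlinarith

/-- The exponential inverts the logarithm. -/
theorem padicExp_padicLog {x : K} (hx : ‖x - 1‖ < padicExpRadius p) :
    padicExp (padicLog x) = x := by
  have := isUltrametricDist_padicAlgebra p (K := K)
  have := charZero_padicAlgebra p (K := K)
  have hL : ‖padicLog x‖ < padicExpRadius p := (norm_padicLog_le hx).trans_lt hx
  set E := padicExp (padicLog x) with hE
  have hE1 : ‖E - 1‖ < padicExpRadius p := (norm_padicExp_sub_one_le hL).trans_lt hL
  have hE0 : E ≠ 0 := left_ne_zero_of_mul_eq_one (padicExp_mul_padicExp_neg hL)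
  have hnE : ‖E‖ = 1 := by
    have h := IsUltrametricDist.norm_add_eq_max_of_norm_ne_norm (x := E - 1) (y := 1)
      (by rw [norm_one]; exact (hE1.trans_le padicExpRadius_le_one).ne)
    rwa [sub_add_cancel, norm_one, max_eq_right (hE1.trans_le padicExpRadius_le_one).le] at h
  have hu : ‖x / E - 1‖ < padicExpRadius p := by
    rw [div_sub_one hE0, norm_div, hnE, div_one, ← sub_sub_sub_cancel_right x E 1]
    exact (norm_sub_le_max_norm _ _).trans_lt (max_lt hx hE1)
  have hdE := tendsto_padicExp_sub_one_div hL
  have hEp : Tendsto (fun n : ℕ => E ^ p ^ n) atTop (𝓝 1) := by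
    have h := ((tendsto_prime_pow_cast p K).mul hdE).add_const 1
    rw [zero_mul, zero_add] at h
    refine h.congr fun n => ?_
    have hn : ((p ^ n : ℕ) : K) ≠ 0 := by exact_mod_cast pow_ne_zero n hp.out.ne_zero
    rw [mul_div_cancel₀ _ hn, sub_add_cancel]
  have hlog : padicLog (x / E) = 0 := by
    refine tendsto_nhds_unique (tendsto_pow_sub_one_div hu) ?_
    -- Difference of the two quotients with common limit `log x`, divided by `E ^ p ^ n → 1`: this
    -- is the quotient for `x / E`.
    have h := ((tendsto_pow_sub_one_div hx).sub hdE).div hEp one_ne_zero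
    rw [sub_self, zero_div] at h
    refine h.congr fun n => ?_
    rw [div_pow, div_sub_one (pow_ne_zero _ hE0), Pi.div_apply, ← sub_div,
      sub_sub_sub_cancel_right, div_right_comm]
  exact ((div_eq_one_iff_eq hE0).1 (eq_one_of_padicLog_eq_zero hu hlog)).symm

end Series

/-! ### The root of unity `ω(3)` -/

section Teichmuller

/-- Of the factors of `w ^ 4 - 1`, `w - 1` and `w + 1` cannot vanish, since 3 is not `±1` modulo 5.
-/
theorem teichmullerRep_three_sq :
    teichmullerRep (3 : ℤ_[5]) isUnit_three_padicInt_five ^ 2 = -1 := by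
  obtain ⟨h4, h3⟩ :=
    (existsUnique_teichmullerRep (3 : ℤ_[5]) isUnit_three_padicInt_five).choose_spec.1
  change teichmullerRep (3 : ℤ_[5]) isUnit_three_padicInt_five ^ 4 = 1 at h4
  change ‖teichmullerRep (3 : ℤ_[5]) isUnit_three_padicInt_five - 3‖ < 1 at h3
  generalize teichmullerRep (3 : ℤ_[5]) isUnit_three_padicInt_five = w at *
  have hnorm : ∀ n : ℕ, Nat.Coprime 5 n → ‖(n : ℤ_[5])‖ = 1 := fun n hn =>
    PadicInt.norm_natCast_eq_one_iff.2 hn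
  have hfac : (w - 1) * ((w + 1) * (w ^ 2 + 1)) = 0 := by linear_combination h4
  rcases mul_eq_zero.1 hfac with h | h
  · have h2 := hnorm 2 (by norm_num)
    rw [show w - 3 = -((2 : ℕ) : ℤ_[5]) by push_cast; linear_combination h, norm_neg, h2] at h3
    exact absurd h3 (lt_irrefl _)
  rcases mul_eq_zero.1 h with h | h
  · have h2 := hnorm 4 (by norm_num)
    rw [show w - 3 = -((4 : ℕ) : ℤ_[5]) by push_cast; linear_combination h, norm_neg, h2] at h3
    exact absurd h3 (lt_irrefl _)
  · linear_combination h

theorem norm_teichmullerRep_three_sub_le :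
    ‖teichmullerRep (3 : ℤ_[5]) isUnit_three_padicInt_five - 3‖ ≤ 5⁻¹ := by
  have h3 : ‖teichmullerRep (3 : ℤ_[5]) isUnit_three_padicInt_five - 3‖ < 1 :=
    (existsUnique_teichmullerRep (3 : ℤ_[5]) isUnit_three_padicInt_five).choose_spec.1.2
  obtain ⟨c, hc⟩ := (PadicInt.norm_lt_one_iff_dvd _).1 h3
  rw [hc, norm_mul, PadicInt.norm_p]
  exact mul_le_of_le_one_right (by positivity) (PadicInt.norm_le_one c)

variable {K : Type*} [NormedField K] [NormedAlgebra ℚ_[5] K]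

theorem omegaThree_sq : omegaThree K ^ 2 = -1 := by
  rw [omegaThree, ← map_pow, ← PadicInt.coe_pow, teichmullerRep_three_sq]
  simp

theorem norm_omegaThree_sub_le : ‖omegaThree K - 3‖ ≤ 5⁻¹ := by
  rw [omegaThree, ← map_ofNat (algebraMap ℚ_[5] K) 3, ← map_sub, norm_algebraMap']
  exact_mod_cast norm_teichmullerRep_three_sub_le

end Teichmuller

/-! ### Binet's formula and the size of `φ / ω(3) - 1` -/

section GoldenRatio

theorem fib_eq_of_sq_sub_sub_one {R : Type*} [CommRing R] {φ : R} (hφ : φ ^ 2 - φ - 1 = 0)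
    (n : ℕ) : (2 * φ - 1) * (Nat.fib n : R) = φ ^ n - (1 - φ) ^ n := by
  induction n using Nat.twoStepInduction with
  | zero => simp
  | one => simp; ring
  | more n h0 h1 =>
    rw [Nat.fib_add_two, Nat.cast_add]
    linear_combination h0 + h1 - (φ ^ n - (1 - φ) ^ n) * hφ

theorem completeSpace_of_adjoin_eq_top {K : Type*} [NormedField K] [NormedAlgebra ℚ_[5] K] {φ : K}
    (hφ : IsIntegral ℚ_[5] φ) (hK : IntermediateField.adjoin ℚ_[5] {φ} = ⊤) :
    CompleteSpace K := by
  have h := IntermediateField.adjoin.finiteDimensional hφ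
  rw [hK] at h
  have := LinearEquiv.finiteDimensional
    (IntermediateField.topEquiv (F := ℚ_[5]) (E := K)).toLinearEquiv
  exact FiniteDimensional.complete ℚ_[5] K

variable {K : Type*} [NormedField K] [NormedAlgebra ℚ_[5] K] {φ : K}

theorem isIntegral_of_sq_sub_sub_one (hφ : φ ^ 2 - φ - 1 = 0) : IsIntegral ℚ_[5] φ :=
  ⟨Polynomial.X ^ 2 - Polynomial.X - 1, by monicity!, by simpa using hφ⟩

theorem norm_five_padicAlgebra : ‖(5 : K)‖ = 5⁻¹ := by
  have h := norm_natCast_padicAlgebra 5 (K := K) 5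
  rw [Padic.norm_p] at h
  exact_mod_cast h

theorem norm_le_one_of_sq_sub_sub_one (hφ : φ ^ 2 - φ - 1 = 0) : ‖φ‖ ≤ 1 := by
  have := isUltrametricDist_padicAlgebra 5 (K := K)
  by_contra! h
  have h1 : ‖φ‖ ^ 2 ≤ ‖φ‖ := by
    rw [← norm_pow, show φ ^ 2 = φ + 1 by linear_combination hφ]
    exact (IsUltrametricDist.norm_add_le_max _ _).trans (by simp [h.le])
  nlinarith

theorem norm_sub_three_sq_le (hφ : φ ^ 2 - φ - 1 = 0) : ‖φ - 3‖ ^ 2 ≤ 5⁻¹ := by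
  have := isUltrametricDist_padicAlgebra 5 (K := K)
  rw [← norm_pow, show (φ - 3) ^ 2 = 5 * (2 - φ) by linear_combination hφ, norm_mul,
    norm_five_padicAlgebra]
  refine mul_le_of_le_one_right (by norm_num) ((norm_sub_le_max_norm _ _).trans
    (max_le ?_ (norm_le_one_of_sq_sub_sub_one hφ)))
  exact_mod_cast norm_natCast_padicAlgebra_le_one 5 (K := K) 2

theorem norm_div_omegaThree_sub_one_lt (hφ : φ ^ 2 - φ - 1 = 0) :
    ‖φ / omegaThree K - 1‖ < padicExpRadius 5 := by
  have := isUltrametricDist_padicAlgebra 5 (K := K)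
  have hω : omegaThree K ≠ 0 := fun h => by simpa [h] using omegaThree_sq (K := K)
  have hnω : ‖omegaThree K‖ = 1 := by
    have h := congrArg norm (omegaThree_sq (K := K))
    rw [norm_pow, norm_neg, norm_one] at h
    exact (pow_eq_one_iff_of_nonneg (norm_nonneg _) two_ne_zero).1 h
  rw [div_sub_one hω, norm_div, hnω, div_one, ← sub_sub_sub_cancel_right φ _ 3]
  have hq : padicExpRadius 5 ^ 4 = (5 : ℝ)⁻¹ := padicExpRadius_pow (p := 5)
  have hω3 := norm_omegaThree_sub_le (K := K)
  -- Fourth powers: `t ^ 4 ≤ 1 / 25 < 1 / 5`.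
  have hpow : ∀ t : ℝ, 0 ≤ t → t ^ 2 ≤ 5⁻¹ → t < padicExpRadius 5 := fun t h0 ht =>
    lt_of_pow_lt_pow_left₀ 4 (padicExpRadius_pos (p := 5)).le (by rw [hq]; nlinarith)
  refine (norm_sub_le_max_norm _ _).trans_lt (max_lt ?_ ?_)
  · exact hpow _ (norm_nonneg _) (norm_sub_three_sq_le hφ)
  · exact hpow _ (norm_nonneg _) (by nlinarith [norm_nonneg (omegaThree K - 3)])

end GoldenRatio

theorem isPadicAnalytic_padicSinh {p : ℕ} [Fact p.Prime] {K : Type*} [NormedField K]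
    [NormedAlgebra ℚ_[p] K] (c y : K)
    (h : ∀ x : ℤ_[p], Summable (padicExpTerm (algebraMap ℚ_[p] K x * y)) ∧
      Summable (padicExpTerm (-(algebraMap ℚ_[p] K x * y)))) :
    IsPadicAnalytic fun x : ℤ_[p] => c * padicSinh (algebraMap ℚ_[p] K x * y) := by
  refine ⟨fun m => c * ((padicExpTerm y m - padicExpTerm (-y) m) / 2), fun x => ?_⟩
  refine ((((h x).1.hasSum.sub (h x).2.hasSum).div_const 2).mul_left c).congr_fun fun m => ?_
  rw [← mul_neg]
  simp only [padicExpTerm, mul_pow]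
  ring

theorem corollary5p3 {K : Type*} [NormedField K] [NormedAlgebra ℚ_[5] K] (φ : K)
    (hφ : φ ^ 2 - φ - 1 = 0) (hK : IntermediateField.adjoin ℚ_[5] {φ} = ⊤) :
    -- all series occurring in the formula converge
    Summable (padicLogTerm (φ / omegaThree K)) ∧
    (∀ x : ℤ_[5],
      Summable (padicExpTerm
        (algebraMap ℚ_[5] K (x : ℚ_[5]) * padicLog (φ / omegaThree K))) ∧
      Summable (padicExpTerm
        (-(algebraMap ℚ_[5] K (x : ℚ_[5]) * padicLog (φ / omegaThree K))))) ∧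
    -- the function is analytic and extends `F(n) / ω(3) ^ n`
    IsPadicAnalytic (p := 5) (fibInterpolation φ) ∧
    ∀ n : ℕ, fibInterpolation φ (n : ℤ_[5]) = (Nat.fib n : K) / omegaThree K ^ n := by
  have := completeSpace_of_adjoin_eq_top (isIntegral_of_sq_sub_sub_one hφ) hK
  have := charZero_padicAlgebra 5 (K := K)
  have hx := norm_div_omegaThree_sub_one_lt hφ
  have hL := (norm_padicLog_le hx).trans_lt hx
  have hexp := padicExp_padicLog hx
  have hsum : ∀ x : ℤ_[5], Summable (padicExpTerm
        (algebraMap ℚ_[5] K (x : ℚ_[5]) * padicLog (φ / omegaThree K))) ∧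
      Summable (padicExpTerm
        (-(algebraMap ℚ_[5] K (x : ℚ_[5]) * padicLog (φ / omegaThree K)))) := fun x => by
    have hxL : ‖algebraMap ℚ_[5] K (x : ℚ_[5]) * padicLog (φ / omegaThree K)‖
        < padicExpRadius 5 := by
      rw [norm_mul, norm_algebraMap']
      exact (mul_le_of_le_one_left (norm_nonneg _) (PadicInt.norm_le_one x)).trans_lt hL
    exact ⟨summable_padicExpTerm hxL, summable_padicExpTerm (by rwa [norm_neg])⟩
  refine ⟨summable_padicLogTerm hx, hsum, isPadicAnalytic_padicSinh _ _ hsum, fun n => ?_⟩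
  have hω2 := omegaThree_sq (K := K)
  have hω : omegaThree K ≠ 0 := fun h => by simp [h] at hω2
  have hφ0 : φ ≠ 0 := fun h => by simp [h] at hφ
  have hs : 2 * φ - 1 ≠ 0 := fun h => by
    -- From `(2 * φ - 1) ^ 2 = 5`.
    have h5 : (5 : K) = 0 := by linear_combination (2 * φ - 1) * h - 4 * hφ
    norm_num at h5
  have hneg : padicExp (-padicLog (φ / omegaThree K)) = (1 - φ) / omegaThree K := by
    have h := padicExp_mul_padicExp_neg hL
    rw [hexp] at h
    rw [eq_div_iff hω, ← mul_right_inj' (div_ne_zero hφ0 hω), ← mul_assoc, h]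
    field_simp
    linear_combination hω2 + hφ
  rw [fibInterpolation, padicSinh, PadicInt.coe_natCast, map_natCast, ← mul_neg,
    padicExp_natCast_mul hL, padicExp_natCast_mul (by rwa [norm_neg]), hexp, hneg, div_pow, div_pow,
    ← sub_div, ← fib_eq_of_sq_sub_sub_one hφ n]
  field_simp
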